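/- Theorem 3.1. A similitude of $\mathbb{R}^2$ with scaling factor $k>0$ is a map of the form $f(p)=k\,Q\,p+v$, where $v\in\mathbb{R}^2$ and, for some $\theta\in[0,2\pi)$, $Q$ is the rotation $\begin{pmatrix}\cos\theta&-\sin\theta\\ \sin\theta&\cos\theta\end{pmatrix}$ or the reflection $\begin{pmatrix}\cos\theta&\sin\theta\\ \sin\theta&-\cos\theta\end{pmatrix}$; it is contractive if $k<1$. The attractor of an iterated function system (IFS) $\{\mathbb{R}^2;f_1,\dots,f_n\}$ consisting of contractive similitudes is the unique nonempty compact set $K\subset\mathbb{R}^2$ with $K=f_1(K)\cup\dots\cup f_n(K)$. Let $G$ be the Sierpinski gasket with vertices $(0,0)$, $(1,0)$, $(\tfrac12,\tfrac{\sqrt3}{2})$, that is, the attractor of the IFS consisting of the three maps $$p\mapsto \tfrac12 p,\qquad p\mapsto \tfrac12 p+\left(\tfrac14,\tfrac{\sqrt3}{4}\right),\qquad p\mapsto \tfrac12 p+\left(\tfrac12,0\right),$$ and let $$E=\bigcup_{i=0}^{4}\bigl(G+(i,0)\bigr)$$ be the five-Sierpinski. Then $E$ is not the attractor of any IFS $\{\mathbb{R}^2;f_1,\dots,f_n\}$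 consisting of finitely many contractive similitudes of $\mathbb{R}^2$. -/

import Mathlib

namespace FiveSierpinski

/-- The Euclidean plane `ℝ²`. -/
abbrev Plane : Type := EuclideanSpace ℝ (Fin 2)

/-- `f` is a similitude of the plane with scaling factor `k > 0`: a rotation by an angle `θ`,
possibly composed with a reflection, followed by scaling by `k` and a translation. -/
def IsSimilitudeWith (k : ℝ) (f : Plane → Plane) : Prop :=
  0 < k ∧ ∃ θ ∈ Set.Ico 0 (2 * Real.pi), ∃ x₀ y₀ : ℝ,
    (∀ x y : ℝ, f !₂[x, y] =
      !₂[k * (Real.cos θ * x - Real.sin θ * y) + x₀,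
         k * (Real.sin θ * x + Real.cos θ * y) + y₀]) ∨
    (∀ x y : ℝ, f !₂[x, y] =
      !₂[k * (Real.cos θ * x + Real.sin θ * y) + x₀,
         k * (Real.sin θ * x - Real.cos θ * y) + y₀])

/-- A contractive similitude: a similitude whose scaling factor is strictly less than `1`. -/
def IsContractiveSimilitude (f : Plane → Plane) : Prop :=
  ∃ k : ℝ, k < 1 ∧ IsSimilitudeWith k f

/-- An iterated function system on the plane: finitely many continuous self-maps. -/
structure IFS where
  n : ℕ
  map : Fin n → Plane → Plane
  continuous_map : ∀ i, Continuous (map i)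

/-- A contractive IFS consisting of similitudes. -/
def IFS.IsContractiveSimilitudes (F : IFS) : Prop :=
  ∀ i, IsContractiveSimilitude (F.map i)

/-- `K` is the attractor of `F`: a nonempty compact set with `K = f₁(K) ∪ ⋯ ∪ fₙ(K)`. For an IFS
of contractions on the plane there is exactly one such set if `n ≥ 1`
(`IFS.existsUnique_isAttractor`), and there is none if `n = 0`. -/
def IFS.IsAttractor (F : IFS) (K : Set Plane) : Prop :=
  K.Nonempty ∧ IsCompact K ∧ K = ⋃ i, F.map i '' K

theorem hausdorffEDist_image_le {c : NNReal} {f : Plane → Plane} (hf : LipschitzWith c f)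
    {s t : Set Plane} (hs : IsCompact s) (ht : IsCompact t) (hs' : s.Nonempty)
    (ht' : t.Nonempty) :
    Metric.hausdorffEDist (f '' s) (f '' t) ≤ c * Metric.hausdorffEDist s t := by
  refine Metric.hausdorffEDist_le_of_mem_edist ?_ ?_
  · rintro _ ⟨x, hx, rfl⟩
    obtain ⟨y, hy, hxy⟩ := ht.exists_infEDist_eq_edist ht' x
    refine ⟨f y, ⟨y, hy, rfl⟩, (hf x y).trans ?_⟩
    rw [← hxy]
    gcongr
    exact Metric.infEDist_le_hausdorffEDist_of_mem hx
  · rintro _ ⟨x, hx, rfl⟩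
    obtain ⟨y, hy, hxy⟩ := hs.exists_infEDist_eq_edist hs' x
    refine ⟨f y, ⟨y, hy, rfl⟩, (hf x y).trans ?_⟩
    rw [← hxy, Metric.hausdorffEDist_comm]
    gcongr
    exact Metric.infEDist_le_hausdorffEDist_of_mem hx

/-- A nonempty IFS of contractions has exactly one attractor. -/
theorem IFS.existsUnique_isAttractor (F : IFS) (hn : 0 < F.n) {c : NNReal} (hc : c < 1)
    (hF : ∀ i, LipschitzWith c (F.map i)) : ∃! K : Set Plane, F.IsAttractor K := by
  let H : TopologicalSpace.NonemptyCompacts Plane → TopologicalSpace.NonemptyCompacts Plane :=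
    fun K => ⟨⟨⋃ i, F.map i '' (K : Set Plane),
      isCompact_iUnion fun i => K.isCompact.image (F.continuous_map i)⟩,
      Set.nonempty_iUnion.2 ⟨⟨0, hn⟩, K.nonempty.image _⟩⟩
  have hH : ContractingWith c H := by
    refine ⟨hc, fun K L => ?_⟩
    change Metric.hausdorffEDist (⋃ i, F.map i '' (K : Set Plane))
      (⋃ i, F.map i '' (L : Set Plane)) ≤ c * Metric.hausdorffEDist (K : Set Plane) L
    exact Metric.hausdorffEDist_iUnion_le.trans (iSup_le fun i =>
      hausdorffEDist_image_le (hF i) K.isCompact L.isCompact K.nonempty L.nonempty)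
  have : Nonempty (TopologicalSpace.NonemptyCompacts Plane) := ⟨{0}⟩
  let A : TopologicalSpace.NonemptyCompacts Plane := ContractingWith.fixedPoint H hH
  have hA : H A = A := hH.fixedPoint_isFixedPt
  refine ⟨(A : Set Plane), ⟨A.nonempty, A.isCompact,
    (congrArg (fun K : TopologicalSpace.NonemptyCompacts Plane => (K : Set Plane)) hA).symm⟩, ?_⟩
  rintro K ⟨hK, hK', h⟩
  have hfix : Function.IsFixedPt H ⟨⟨K, hK'⟩, hK⟩ := SetLike.coe_injective h.symm
  exact congrArg (fun K : TopologicalSpace.NonemptyCompacts Plane => (K : Set Plane))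
    (hH.fixedPoint_unique hfix)

/-- The translation vectors `(0, 0)`, `(1/4, √3/4)`, `(1/2, 0)`. -/
noncomputable def gasketShift : Fin 3 → Plane :=
  ![!₂[0, 0], !₂[1 / 4, Real.sqrt 3 / 4], !₂[1 / 2, 0]]

/-- The IFS of the Sierpinski gasket: the three maps `p ↦ p / 2 + v` for the three vectors `v`. -/
noncomputable def gasketIFS : IFS where
  n := 3
  map i p := (1 / 2 : ℝ) • p + gasketShift i
  continuous_map _ := by fun_prop

theorem existsUnique_isAttractor_gasketIFS : ∃! K : Set Plane, gasketIFS.IsAttractor K := by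
  refine gasketIFS.existsUnique_isAttractor (by decide) (c := 1 / 2)
    (by rw [← NNReal.coe_lt_coe]; norm_num) fun i => ?_
  refine LipschitzWith.of_dist_le_mul fun p q => ?_
  change dist ((1 / 2 : ℝ) • p + gasketShift i) ((1 / 2 : ℝ) • q + gasketShift i) ≤ _
  rw [dist_add_right, dist_smul₀]
  simp

/-- The Sierpinski gasket: the attractor of `gasketIFS`. It is the gasket with vertices `(0, 0)`,
`(1, 0)`, `(1/2, √3/2)`. -/
noncomputable def sierpinskiGasket : Set Plane :=
  existsUnique_isAttractor_gasketIFS.choose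

theorem isAttractor_sierpinskiGasket : gasketIFS.IsAttractor sierpinskiGasket :=
  existsUnique_isAttractor_gasketIFS.choose_spec.1

/-- The `N`-Sierpinski: the union of the `(N-1)`-Sierpinski and the Sierpinski gasket translated
along the positive `x` axis by `N - 1` units (so the `1`-Sierpinski is the gasket itself). -/
noncomputable def nSierpinski : ℕ → Set Plane
  | 0 => ∅
  | N + 1 => nSierpinski N ∪ (fun p : Plane => p + !₂[(N : ℝ), 0]) '' sierpinskiGasket

/-- The five-Sierpinski. -/
noncomputable def fiveSierpinski : Set Plane := nSierpinski 5

end FiveSierpinski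

/-!
Let `G` be the gasket and `E` the five-Sierpinski. If `E` were the attractor of contractive
similitudes, every point of `E` would lie in a set `f(E) ⊆ E` with `f` a contractive similitude. The
point `spiralPoint 1`, with barycentric coordinates `2/7` (right), `4/7` (top), `1/7` (left) in the
first gasket, lies in no such set. In the address of this point any three consecutive letters are
distinct, so none of its cells of level `n` touches a side of its cell of level `n - 3`, whereas a
row of five cells of equal size lies along the base of `E` or along a side of a cell at least three
levels up.

To handle copies that are not known in advance to consist of cells, the argument uses that a small
copy of `G` in `G` lies in one of the three first-level cells (`IsSim.exists_homothety_two_mem`),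
and a copy of `G` in `E` lies in one of the five gaskets (`IsSim.exists_shift_neg_mem`). The reason
is that a side of the copy that crosses from one cell to another must run along a side of the
triangle (or along the base of `E`), and then the third vertex of the copy (`apex`) falls into a
hole or a gap.

Let `f(E) ⊆ G` have ratio `k`; then `k ≤ 1/5`. If the five gaskets of `f(E)` lie in one first-level
cell, doubling this cell gives a copy of ratio `2 * k` containing the next point of the cycle
formed by the three `spiralPoint`s, so this can be repeated only finitely often. Otherwise two
neighbouring gaskets lie in different cells; their common point is the common point of the cells,
which forces the base of `f(E)` onto a side of the triangle. Each of the five gaskets then stands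
on one of the four intervals of length `1/4` of this side, whence `k ≤ 1/8`
(`IsSim.le_eighth`), but the distance of a `spiralPoint` to the side is at least `1/7` of the height
of `G`. So `f(E)` does not contain it (`IsSim.apply_shift_ne_spiralPoint`).

For `f(E) ⊆ E`, either all of `f(E)` is in one gasket, or in the same way the base of `f(E)` is on
the base of `E`. In the latter case the height `4/7` of the point gives `k ≥ 4/7`, so the five
gaskets of `f(E)` lie in the five gaskets of `E`, one in each, and this forces `k ≥ 1`
(`one_le_of_row`).
-/

namespace FiveSierpinski

/-! ### Barycentric coordinates -/

/-- The vertices of the gasket: left `(0, 0)`, top `(1/2, √3/2)`, right `(1, 0)`, in the order of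
the maps of `gasketIFS`. -/
noncomputable def vertex (i : Fin 3) : Plane := (2 : ℝ) • gasketShift i

/-- The linear parts of the barycentric coordinates with respect to `vertex`. -/
noncomputable def baryLinear (i : Fin 3) : Plane →ₗ[ℝ] ℝ where
  toFun p := ![-p 0 - p 1 / Real.sqrt 3, 2 * p 1 / Real.sqrt 3, p 0 - p 1 / Real.sqrt 3] i
  map_add' p q := by fin_cases i <;> simp <;> ring
  map_smul' c p := by fin_cases i <;> simp <;> ring

/-- The barycentric coordinates with respect to `vertex`. -/
noncomputable def bary (i : Fin 3) : Plane →ᵃ[ℝ] ℝ where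
  toFun p := baryLinear i p + if i = 0 then 1 else 0
  linear := baryLinear i
  map_vadd' p v := by simp; ring

theorem bary_apply (i : Fin 3) (p : Plane) :
    bary i p = ![-p 0 - p 1 / Real.sqrt 3, 2 * p 1 / Real.sqrt 3, p 0 - p 1 / Real.sqrt 3] i
      + if i = 0 then 1 else 0 := rfl

theorem bary_sum {i j m : Fin 3} (hij : i ≠ j) (hjm : j ≠ m) (him : i ≠ m) (p : Plane) :
    bary i p + bary j p + bary m p = 1 := by
  fin_cases i <;> fin_cases j <;> fin_cases m <;> simp_all [bary_apply] <;> ring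

theorem sum_bary_eq_one (p : Plane) : bary 0 p + bary 1 p + bary 2 p = 1 :=
  bary_sum (by decide) (by decide) (by decide) p

theorem bary_vertex (i j : Fin 3) : bary i (vertex j) = if i = j then 1 else 0 := by
  have h : Real.sqrt 3 ≠ 0 := by positivity
  fin_cases i <;> fin_cases j <;> simp [bary_apply, vertex, gasketShift] <;> field_simp <;>
    norm_num

theorem dist_sq_eq {i j m : Fin 3} (hij : i ≠ j) (hjm : j ≠ m) (him : i ≠ m) (p q : Plane) :
    dist p q ^ 2 = ((bary i p - bary i q) ^ 2 + (bary j p - bary j q) ^ 2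
      + (bary m p - bary m q) ^ 2) / 2 := by
  have h : Real.sqrt 3 ^ 2 = 3 := Real.sq_sqrt (by norm_num)
  have h0 : Real.sqrt 3 ≠ 0 := by positivity
  rw [EuclideanSpace.dist_eq, Real.sq_sqrt (by positivity)]
  have key : (p 0 - q 0) ^ 2 + (p 1 - q 1) ^ 2 =
      ((bary 0 p - bary 0 q) ^ 2 + (bary 1 p - bary 1 q) ^ 2 + (bary 2 p - bary 2 q) ^ 2) / 2 := by
    simp only [bary_apply]
    simp
    field_simp
    rw [h]
    linear_combination (-2 * (p 0 - q 0) ^ 2) * h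
  simp only [Fin.sum_univ_two, Real.dist_eq, sq_abs]
  rw [key]
  fin_cases i <;> fin_cases j <;> fin_cases m <;> simp_all <;> ring

theorem eq_of_bary {p q : Plane} (h : ∀ i, bary i p = bary i q) : p = q := by
  have := dist_sq_eq (i := 0) (j := 1) (m := 2) (by decide) (by decide) (by decide) p q
  simp only [h, sub_self] at this
  exact dist_eq_zero.1 (pow_eq_zero_iff two_ne_zero |>.1 (by simpa using this))

theorem eq_sum_bary (p : Plane) : p = ∑ i, bary i p • vertex i := by
  have h : Real.sqrt 3 ≠ 0 := by positivity
  ext l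
  fin_cases l <;> simp [Fin.sum_univ_three, bary_apply, vertex, gasketShift] <;> field_simp <;> ring

theorem affine_apply_eq_sum (φ : Plane →ᵃ[ℝ] ℝ) (p : Plane) :
    φ p = ∑ i, bary i p * φ (vertex i) := by
  have h (q : Plane) : φ q = φ.linear q + φ 0 := congrFun φ.decomp q
  have hs := sum_bary_eq_one p
  rw [h p]
  conv_lhs => rw [eq_sum_bary p]
  simp only [h (vertex _), Fin.sum_univ_three, map_add, map_smul, smul_eq_mul]
  linear_combination (-φ 0) * hs

theorem bary_add (i : Fin 3) (p v : Plane) : bary i (p + v) = bary i p + baryLinear i v := by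
  rw [add_comm, ← vadd_eq_add, AffineMap.map_vadd]
  simp [bary, add_comm]

/-- Horizontal translation by `t`. -/
noncomputable def shift (t : ℝ) : Plane →ᵃ[ℝ] Plane :=
  (AffineEquiv.constVAdd ℝ Plane !₂[t, 0]).toAffineMap

theorem shift_apply (t : ℝ) (p : Plane) : shift t p = p + !₂[t, 0] := by
  simp [shift, add_comm]

theorem bary_shift (i : Fin 3) (t : ℝ) (p : Plane) :
    bary i (shift t p) = bary i p + ![-t, 0, t] i := by
  rw [shift_apply, bary_add]
  congr 1
  fin_cases i <;> simp [baryLinear]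

theorem shift_shift (s t : ℝ) (p : Plane) : shift s (shift t p) = shift (s + t) p := by
  refine eq_of_bary fun i => ?_
  simp only [bary_shift]
  fin_cases i <;> simp <;> ring

theorem bary_homothety (i j : Fin 3) (r : ℝ) (p : Plane) :
    bary j (AffineMap.homothety (vertex i) r p) =
      r * bary j p + (1 - r) * (if j = i then 1 else 0) := by
  rw [AffineMap.homothety_eq_lineMap, AffineMap.apply_lineMap, AffineMap.lineMap_apply,
    bary_vertex]
  simp only [vsub_eq_sub, smul_eq_mul, vadd_eq_add]
  ring

theorem bary_lineMap (i : Fin 3) (p q : Plane) (t : ℝ) :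
    bary i (AffineMap.lineMap p q t) = (1 - t) * bary i p + t * bary i q := by
  rw [AffineMap.apply_lineMap, AffineMap.lineMap_apply]
  simp
  ring

/-! ### Points of the gasket -/

theorem gasketIFS_map_eq (i : Fin 3) (p : Plane) :
    gasketIFS.map i p = AffineMap.homothety (vertex i) (1 / 2 : ℝ) p := by
  change (1 / 2 : ℝ) • p + gasketShift i = _
  rw [AffineMap.homothety_apply, vertex]
  simp only [vsub_eq_sub, vadd_eq_add]
  module

theorem exists_of_mem_gasket {p : Plane} (hp : p ∈ sierpinskiGasket) :
    ∃ i, ∃ q ∈ sierpinskiGasket, AffineMap.homothety (vertex i) (1 / 2 : ℝ) q = p := by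
  rw [isAttractor_sierpinskiGasket.2.2] at hp
  obtain ⟨i, q, hq, rfl⟩ := Set.mem_iUnion.1 hp
  exact ⟨i, q, hq, (gasketIFS_map_eq i q).symm⟩

theorem homothety_mem_gasket (i : Fin 3) {p : Plane} (hp : p ∈ sierpinskiGasket) :
    AffineMap.homothety (vertex i) (1 / 2 : ℝ) p ∈ sierpinskiGasket := by
  rw [isAttractor_sierpinskiGasket.2.2]
  exact Set.mem_iUnion.2 ⟨i, p, hp, gasketIFS_map_eq i p⟩

/-- A bounded set whose points are images of points of the set under maps of `gasketIFS` lies in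
the gasket: the distance to the gasket halves with every step back. -/
theorem subset_gasket {A : Set Plane} (hA : Bornology.IsBounded A)
    (h : ∀ p ∈ A, ∃ i, ∃ q ∈ A, AffineMap.homothety (vertex i) (1 / 2 : ℝ) q = p) :
    A ⊆ sierpinskiGasket := by
  obtain ⟨⟨g₀, hg₀⟩, hc, -⟩ := isAttractor_sierpinskiGasket
  obtain ⟨M, hM⟩ := hA.subset_closedBall g₀
  have key (n : ℕ) : ∀ p ∈ A, ∃ g ∈ sierpinskiGasket, dist p g ≤ M * (1 / 2) ^ n := by
    induction n with
    | zero => exact fun p hp => ⟨g₀, hg₀, by simpa using hM hp⟩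
    | succ n ih =>
      intro p hp
      obtain ⟨i, q, hq, rfl⟩ := h p hp
      obtain ⟨g, hg, hd⟩ := ih q hq
      refine ⟨_, homothety_mem_gasket i hg, ?_⟩
      rw [← gasketIFS_map_eq, ← gasketIFS_map_eq]
      change dist ((1 / 2 : ℝ) • q + gasketShift i) ((1 / 2 : ℝ) • g + gasketShift i) ≤ _
      rw [dist_add_right, dist_smul₀, pow_succ]
      norm_num
      norm_num at hd
      linarith
  intro p hp
  rw [← hc.isClosed.closure_eq, Metric.mem_closure_iff]
  intro ε hε
  have ht : Filter.Tendsto (fun n : ℕ => M * (1 / 2 : ℝ) ^ n) Filter.atTop (nhds (M * 0)) :=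
    (tendsto_pow_atTop_nhds_zero_of_lt_one (by norm_num) (by norm_num)).const_mul M
  rw [mul_zero] at ht
  obtain ⟨n, hn⟩ := (ht.eventually (gt_mem_nhds hε)).exists
  obtain ⟨g, hg, hd⟩ := key n p hp
  exact ⟨g, hg, hd.trans_lt hn⟩

theorem isBounded_bary_nonneg : Bornology.IsBounded {p : Plane | ∀ i, 0 ≤ bary i p} := by
  rw [Metric.isBounded_iff]
  refine ⟨2, fun p hp q hq => ?_⟩
  have hd := dist_sq_eq (i := 0) (j := 1) (m := 2) (by decide) (by decide) (by decide) p q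
  have h1 := sum_bary_eq_one p
  have h2 := sum_bary_eq_one q
  have hp0 := hp 0; have hp1 := hp 1; have hp2 := hp 2
  have hq0 := hq 0; have hq1 := hq 1; have hq2 := hq 2
  have sq_le {x : ℝ} (h : -1 ≤ x) (h' : x ≤ 1) : x ^ 2 ≤ 1 :=
    (sq_le_one_iff_abs_le_one x).2 (abs_le.2 ⟨h, h'⟩)
  have e0 := sq_le (x := bary 0 p - bary 0 q) (by linarith) (by linarith)
  have e1 := sq_le (x := bary 1 p - bary 1 q) (by linarith) (by linarith)
  have e2 := sq_le (x := bary 2 p - bary 2 q) (by linarith) (by linarith)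
  nlinarith [dist_nonneg (x := p) (y := q)]

/-- The gasket lies in the triangle spanned by its vertices: the negative part of a coordinate,
which halves with every map, vanishes by compactness. -/
theorem bary_nonneg {p : Plane} (hp : p ∈ sierpinskiGasket) (i : Fin 3) : 0 ≤ bary i p := by
  obtain ⟨q, hq, hmin⟩ := isAttractor_sierpinskiGasket.2.1.exists_isMinOn
    isAttractor_sierpinskiGasket.1 (bary i).continuous_of_finiteDimensional.continuousOn
  obtain ⟨j, r, hr, hrq⟩ := exists_of_mem_gasket hq
  have h1 : bary i q ≤ bary i r := hmin hr
  have h2 : bary i q ≤ bary i p := hmin hp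
  have h3 := bary_homothety j i (1 / 2) r
  rw [hrq] at h3
  split_ifs at h3 <;> linarith

theorem bary_le_one {p : Plane} (hp : p ∈ sierpinskiGasket) (i : Fin 3) : bary i p ≤ 1 := by
  have h1 := sum_bary_eq_one p
  have h := bary_nonneg hp
  have h0 := h 0; have h1 := h 1; have h2 := h 2
  fin_cases i <;> simp <;> linarith

theorem exists_half_le_bary {p : Plane} (hp : p ∈ sierpinskiGasket) :
    ∃ i, 1 / 2 ≤ bary i p := by
  obtain ⟨i, q, hq, rfl⟩ := exists_of_mem_gasket hp
  refine ⟨i, ?_⟩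
  rw [bary_homothety]
  have := bary_nonneg hq i
  simp; linarith

theorem exists_third {i j : Fin 3} (h : i ≠ j) : ∃ m, j ≠ m ∧ i ≠ m := by
  revert i j; decide

theorem eq_or_eq_or_eq {i j m : Fin 3} (hij : i ≠ j) (hjm : j ≠ m) (him : i ≠ m) (l : Fin 3) :
    l = i ∨ l = j ∨ l = m := by
  revert i j m l; decide

/-- The boundary of the triangle lies in the gasket. -/
theorem mem_gasket_of_bary_eq_zero {p : Plane} (h : ∀ i, 0 ≤ bary i p) {m : Fin 3}
    (hm : bary m p = 0) : p ∈ sierpinskiGasket := by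
  refine subset_gasket (A := {p | (∀ i, 0 ≤ bary i p) ∧ ∃ m, bary m p = 0})
    (isBounded_bary_nonneg.subset fun p hp => hp.1) ?_ ⟨h, m, hm⟩
  rintro p ⟨h, m, hm⟩
  have key : ∃ i, i ≠ m ∧ 1 / 2 ≤ bary i p := by
    obtain ⟨i, hi⟩ : ∃ i, m ≠ i := ⟨m + 1, by clear hm; revert m; decide⟩
    obtain ⟨j, hij, hmj⟩ := exists_third hi
    have := bary_sum hi hij hmj p
    by_cases hh : 1 / 2 ≤ bary i p
    · exact ⟨i, hi.symm, hh⟩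
    · exact ⟨j, hmj.symm, by linarith⟩
  obtain ⟨i, him, hi⟩ := key
  refine ⟨i, AffineMap.homothety (vertex i) (2 : ℝ) p, ⟨fun l => ?_, m, ?_⟩,
    eq_of_bary fun l => ?_⟩
  · rw [bary_homothety]
    have := h l
    split_ifs with hl
    · subst hl; linarith
    · linarith
  · rw [bary_homothety, hm, if_neg him.symm]; norm_num
  · rw [bary_homothety, bary_homothety]; ring

theorem vertex_mem_gasket (i : Fin 3) : vertex i ∈ sierpinskiGasket := by
  obtain ⟨m, hm⟩ : ∃ m, m ≠ i := by revert i; decide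
  refine mem_gasket_of_bary_eq_zero (fun j => ?_) (m := m) ?_
  · rw [bary_vertex]; split_ifs <;> norm_num
  · rw [bary_vertex, if_neg hm]

theorem lineMap_mem_gasket (i j : Fin 3) {t : ℝ} (h0 : 0 ≤ t) (h1 : t ≤ 1) :
    AffineMap.lineMap (vertex i) (vertex j) t ∈ sierpinskiGasket := by
  obtain ⟨m, hi, hj⟩ : ∃ m, m ≠ i ∧ m ≠ j := by revert i j; decide
  refine mem_gasket_of_bary_eq_zero (fun l => ?_) (m := m) ?_
  · rw [bary_lineMap, bary_vertex, bary_vertex]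
    split_ifs <;> simp <;> linarith
  · rw [bary_lineMap, bary_vertex, bary_vertex, if_neg hi, if_neg hj]; ring

/-- A point of the gasket in the triangle of a first-level cell belongs to that cell. The only
points in doubt are the common vertices of two cells. -/
theorem homothety_two_mem_gasket {p : Plane} (hp : p ∈ sierpinskiGasket) {i : Fin 3}
    (hi : 1 / 2 ≤ bary i p) : AffineMap.homothety (vertex i) (2 : ℝ) p ∈ sierpinskiGasket := by
  obtain ⟨j, q, hq, rfl⟩ := exists_of_mem_gasket hp
  by_cases hij : i = j
  · subst hij
    convert hq using 1
    refine eq_of_bary fun l => ?_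
    rw [bary_homothety, bary_homothety]; ring
  · convert vertex_mem_gasket j using 1
    obtain ⟨m, hjm, him⟩ := exists_third hij
    have hs := bary_sum hij hjm him q
    have hj0 := bary_nonneg hq j
    have hm0 := bary_nonneg hq m
    rw [bary_homothety, if_neg hij] at hi
    refine eq_of_bary fun l => ?_
    rw [bary_homothety, bary_homothety, bary_vertex]
    rcases eq_or_eq_or_eq hij hjm him l with rfl | rfl | rfl
    · rw [if_pos rfl, if_neg hij]; linarith
    · rw [if_pos rfl, if_neg (Ne.symm hij)]; linarith
    · rw [if_neg (Ne.symm hjm), if_neg (Ne.symm him)]; linarith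

/-! ### A cycle of points of the gasket -/

/-- The point whose address in the gasket is the periodic word `i, i + 1, i + 2, …`: any three
consecutive letters are distinct. -/
noncomputable def spiralPoint (i : Fin 3) : Plane :=
  (4 / 7 : ℝ) • vertex i + (2 / 7 : ℝ) • vertex (i + 1) + (1 / 7 : ℝ) • vertex (i + 2)

theorem bary_spiralPoint (i j : Fin 3) : bary j (spiralPoint i) =
    if j = i then 4 / 7 else if j = i + 1 then 2 / 7 else 1 / 7 := by
  have h : Real.sqrt 3 ≠ 0 := by positivity
  fin_cases i <;> fin_cases j <;>
    simp [spiralPoint, bary_apply, vertex, gasketShift] <;> field_simp <;> norm_num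

theorem homothety_two_spiralPoint (i : Fin 3) :
    AffineMap.homothety (vertex i) (2 : ℝ) (spiralPoint i) = spiralPoint (i + 1) := by
  refine eq_of_bary fun j => ?_
  rw [bary_homothety, bary_spiralPoint, bary_spiralPoint]
  fin_cases i <;> fin_cases j <;> simp <;> norm_num

theorem spiralPoint_mem_gasket (i : Fin 3) : spiralPoint i ∈ sierpinskiGasket := by
  refine subset_gasket (A := Set.range spiralPoint) (Set.finite_range _).isBounded ?_ ⟨i, rfl⟩
  rintro _ ⟨i, rfl⟩
  refine ⟨i, spiralPoint (i + 1), ⟨i + 1, rfl⟩, ?_⟩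
  rw [← homothety_two_spiralPoint]
  refine eq_of_bary fun l => ?_
  rw [bary_homothety, bary_homothety]; ring

/-! ### Similarities -/

/-- An affine self-map of the plane multiplying all distances by `k > 0`. -/
structure IsSim (k : ℝ) (f : Plane →ᵃ[ℝ] Plane) : Prop where
  pos : 0 < k
  dist_eq : ∀ p q, dist (f p) (f q) = k * dist p q

theorem IsSim.comp_shift {k : ℝ} {f : Plane →ᵃ[ℝ] Plane} (hf : IsSim k f) (t : ℝ) :
    IsSim k (f.comp (shift t)) :=
  ⟨hf.pos, fun p q => by simp [hf.dist_eq, shift_apply]⟩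

theorem IsSim.homothety_two_comp {k : ℝ} {f : Plane →ᵃ[ℝ] Plane} (hf : IsSim k f) (c : Plane) :
    IsSim (2 * k) ((AffineMap.homothety c (2 : ℝ)).comp f) :=
  ⟨by linarith [hf.pos], fun p q => by
    simp [AffineMap.homothety_apply, dist_smul₀, hf.dist_eq, mul_assoc]⟩

/-- A similitude, given by its rotation or reflection matrix, is affine and scales distances. -/
theorem IsSimilitudeWith.exists_isSim {k : ℝ} {f : Plane → Plane} (hf : IsSimilitudeWith k f) :
    ∃ g : Plane →ᵃ[ℝ] Plane, IsSim k g ∧ ∀ p, g p = f p := by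
  obtain ⟨hk, θ, -, x₀, y₀, h⟩ := hf
  have key : ∀ a b c d : ℝ, a ^ 2 + c ^ 2 = k ^ 2 → b ^ 2 + d ^ 2 = k ^ 2 → a * b + c * d = 0 →
      (∀ x y : ℝ, f !₂[x, y] = !₂[a * x + b * y + x₀, c * x + d * y + y₀]) →
      ∃ g : Plane →ᵃ[ℝ] Plane, IsSim k g ∧ ∀ p, g p = f p := by
    intro a b c d h1 h2 h3 hf
    have hf' (p : Plane) : f p = !₂[a * p 0 + b * p 1 + x₀, c * p 0 + d * p 1 + y₀] := by
      rw [← hf]; congr 1; ext i; fin_cases i <;> rfl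
    refine ⟨⟨f, ⟨⟨fun p => !₂[a * p 0 + b * p 1, c * p 0 + d * p 1], fun p q => ?_⟩,
      fun r p => ?_⟩, fun p v => ?_⟩, ⟨hk, fun p q => ?_⟩, fun _ => rfl⟩
    · ext i; fin_cases i <;> simp <;> ring
    · ext i; fin_cases i <;> simp <;> ring
    · rw [hf', hf']; ext i; fin_cases i <;> simp <;> ring
    · change dist (f p) (f q) = _
      rw [← abs_of_pos hk, ← abs_of_nonneg (dist_nonneg (x := p) (y := q)), ← abs_mul,
        ← abs_of_nonneg (dist_nonneg (x := f p) (y := f q)), ← sq_eq_sq_iff_abs_eq_abs, mul_pow,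
        EuclideanSpace.dist_eq, EuclideanSpace.dist_eq, Real.sq_sqrt (by positivity),
        Real.sq_sqrt (by positivity), hf', hf']
      simp only [Fin.sum_univ_two, Real.dist_eq, sq_abs]
      simp
      linear_combination (p 0 - q 0) ^ 2 * h1 + (p 1 - q 1) ^ 2 * h2 +
        2 * (p 0 - q 0) * (p 1 - q 1) * h3
  have hcs := Real.sin_sq_add_cos_sq θ
  rcases h with h | h
  · refine key (k * Real.cos θ) (-(k * Real.sin θ)) (k * Real.sin θ) (k * Real.cos θ)
      ?_ ?_ ?_ fun x y => ?_
    · linear_combination k ^ 2 * hcs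
    · linear_combination k ^ 2 * hcs
    · ring
    · rw [h]; ext i; fin_cases i <;> simp <;> ring
  · refine key (k * Real.cos θ) (k * Real.sin θ) (k * Real.sin θ) (-(k * Real.cos θ))
      ?_ ?_ ?_ fun x y => ?_
    · linear_combination k ^ 2 * hcs
    · linear_combination k ^ 2 * hcs
    · ring
    · rw [h]; ext i; fin_cases i <;> simp <;> ring

theorem dist_vertex {i j : Fin 3} (h : i ≠ j) : dist (vertex i) (vertex j) = 1 := by
  obtain ⟨m, hjm, him⟩ := exists_third h
  have := dist_sq_eq h hjm him (vertex i) (vertex j)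
  simp only [bary_vertex, if_neg h, if_neg h.symm, if_neg hjm.symm, if_neg him.symm,
    if_true] at this
  have h0 := dist_nonneg (x := vertex i) (y := vertex j)
  nlinarith

theorem IsSim.dist_vertex {k : ℝ} {f : Plane →ᵃ[ℝ] Plane} (hf : IsSim k f) {i j : Fin 3}
    (h : i ≠ j) : dist (f (vertex i)) (f (vertex j)) = k := by
  rw [hf.dist_eq, FiveSierpinski.dist_vertex h, mul_one]

/-- An affine function is bounded below on the gasket by its values at the vertices. -/
theorem le_apply_of_mem_gasket (φ : Plane →ᵃ[ℝ] ℝ) {c : ℝ} (h : ∀ i, c ≤ φ (vertex i))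
    {p : Plane} (hp : p ∈ sierpinskiGasket) : c ≤ φ p := by
  have hs := sum_bary_eq_one p
  rw [affine_apply_eq_sum, Fin.sum_univ_three]
  have h0 := mul_le_mul_of_nonneg_left (h 0) (bary_nonneg hp 0)
  have h1 := mul_le_mul_of_nonneg_left (h 1) (bary_nonneg hp 1)
  have h2 := mul_le_mul_of_nonneg_left (h 2) (bary_nonneg hp 2)
  have : c = bary 0 p * c + bary 1 p * c + bary 2 p * c := by linear_combination (-c) * hs
  linarith

/-- An equilateral triangle with one side on the line `bary m = 0` and its third vertex on the
inner side of that line is a translate of a scaled copy of the triangle of the vertices. -/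
theorem apex {i j m : Fin 3} (hij : i ≠ j) (hjm : j ≠ m) (him : i ≠ m) {k : ℝ} (hk : 0 < k)
    {A B C : Plane} (hA : bary m A = 0) (hB : bary m B = 0) (hC : 0 ≤ bary m C)
    (hAB : dist A B = k) (hAC : dist A C = k) (hBC : dist B C = k)
    (h : bary i B ≤ bary i A) :
    bary i A - bary i B = k ∧ bary i C = bary i B ∧ bary j C = bary j A ∧ bary m C = k := by
  have sA := bary_sum hij hjm him A
  have sB := bary_sum hij hjm him B
  have sC := bary_sum hij hjm him C
  have dAB := dist_sq_eq hij hjm him A B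
  have dAC := dist_sq_eq hij hjm him A C
  have dBC := dist_sq_eq hij hjm him B C
  rw [hAB] at dAB
  rw [hAC] at dAC
  rw [hBC] at dBC
  rw [show bary j A = 1 - bary i A by linarith] at dAB dAC ⊢
  rw [show bary j B = 1 - bary i B by linarith, hB] at dAB dBC
  rw [show bary j C = 1 - bary m C - bary i C by linarith] at dAC dBC ⊢
  rw [hA] at dAB dAC
  generalize bary i A = a at *
  generalize bary i B = b at *
  generalize bary i C = x at *
  generalize bary m C = c at *
  have hab : a - b = k := (sq_eq_sq₀ (by linarith) hk.le).1 (by linarith)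
  have hx : a + b - c - 2 * x = 0 := by
    have : k * (a + b - c - 2 * x) = 0 := by
      rw [← hab]
      linear_combination dBC - dAC
    exact (mul_eq_zero.1 this).resolve_left hk.ne'
  have hck : c = k := (sq_eq_sq₀ hC hk.le).1 <| by
    rw [show x = (a + b - c) / 2 by linarith, show a = b + k by linarith] at dAC
    linarith
  exact ⟨hab, by linarith, by linarith, hck⟩

/-- If the base of a scaled gasket lies on the line `bary m = 0`, then its height over that line
is the scaling factor. -/
theorem IsSim.height {k : ℝ} {f : Plane →ᵃ[ℝ] Plane} (hf : IsSim k f) {m : Fin 3}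
    (h0 : bary m (f (vertex 0)) = 0) (h2 : bary m (f (vertex 2)) = 0)
    (h1 : 0 ≤ bary m (f (vertex 1))) {i : Fin 3} (him : i ≠ m) :
    bary m (f (vertex 1)) = k ∧ |bary i (f (vertex 2)) - bary i (f (vertex 0))| = k := by
  obtain ⟨j, hmj, hij⟩ := exists_third him
  have d02 := hf.dist_vertex (i := 0) (j := 2) (by decide)
  have d01 := hf.dist_vertex (i := 0) (j := 1) (by decide)
  have d21 := hf.dist_vertex (i := 2) (j := 1) (by decide)
  rcases le_total (bary i (f (vertex 2))) (bary i (f (vertex 0))) with h | h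
  · obtain ⟨e, -, -, e'⟩ := apex hij hmj.symm him hf.pos h0 h2 h1 d02 d01 d21 h
    exact ⟨e', by rw [abs_sub_comm, e, abs_of_pos hf.pos]⟩
  · obtain ⟨e, -, -, e'⟩ := apex hij hmj.symm him hf.pos h2 h0 h1 (by rwa [dist_comm]) d21 d01 h
    exact ⟨e', by rw [e, abs_of_pos hf.pos]⟩

/-! ### Similar copies of the gasket in the gasket -/

/-- Two vertices of a small copy of the gasket lie in a common first-level cell. Otherwise the side
between them could avoid the central hole only along a side of the large triangle, and then the
third vertex of the copy would be in the hole. -/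
theorem IsSim.exists_half_le_bary_pair {k : ℝ} {f : Plane →ᵃ[ℝ] Plane} (hf : IsSim k f)
    (hk : k < 1 / 2) (hG : ∀ p ∈ sierpinskiGasket, f p ∈ sierpinskiGasket) {a b : Fin 3}
    (hab : a ≠ b) : ∃ i, 1 / 2 ≤ bary i (f (vertex a)) ∧ 1 / 2 ≤ bary i (f (vertex b)) := by
  by_contra! hcon
  have hA := hG _ (vertex_mem_gasket a)
  have hB := hG _ (vertex_mem_gasket b)
  obtain ⟨i, hi⟩ := exists_half_le_bary hA
  obtain ⟨j, hj⟩ := exists_half_le_bary hB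
  have hi' := hcon i hi
  have hj' : bary j (f (vertex a)) < 1 / 2 := not_le.1 fun h => (hcon j h).not_ge hj
  have hij : i ≠ j := by rintro rfl; linarith
  obtain ⟨m, hjm, him⟩ := exists_third hij
  have hm := hcon m
  have sA := bary_sum hij hjm him (f (vertex a))
  have sB := bary_sum hij hjm him (f (vertex b))
  have nA := bary_nonneg hA
  have nB := bary_nonneg hB
  by_cases hpos : 0 < bary m (f (vertex a)) + bary m (f (vertex b))
  · -- the point of the segment where the coordinates `i` and `j` agree is in a hole of the gasket
    have hseg (t : ℝ) (h0 : 0 ≤ t) (h1 : t ≤ 1) :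
        AffineMap.lineMap (f (vertex a)) (f (vertex b)) t ∈ sierpinskiGasket := by
      rw [← AffineMap.apply_lineMap]
      exact hG _ (lineMap_mem_gasket a b h0 h1)
    set d := bary i (f (vertex a)) - bary j (f (vertex a)) with hd
    set e := bary j (f (vertex b)) - bary i (f (vertex b)) with he
    have hd0 : 0 < d := by linarith
    have he0 : 0 < e := by linarith
    have ht0 : 0 < d / (d + e) := by positivity
    have ht1 : d / (d + e) < 1 := by rw [div_lt_one (by positivity)]; linarith
    have hmul : d / (d + e) * (d + e) = d := div_mul_cancel₀ _ (by positivity)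
    set t := d / (d + e)
    have hp := hseg t ht0.le ht1.le
    have sp := bary_sum hij hjm him (AffineMap.lineMap (f (vertex a)) (f (vertex b)) t)
    obtain ⟨l, hl⟩ := exists_half_le_bary hp
    simp only [bary_lineMap] at sp hl
    have heq : (1 - t) * bary i (f (vertex a)) + t * bary i (f (vertex b)) =
        (1 - t) * bary j (f (vertex a)) + t * bary j (f (vertex b)) := by
      rw [hd, he] at hmul
      linear_combination -hmul
    have hwa : bary m (f (vertex a)) ≤ 1 / 2 := by linarith [nA j]
    have hwb : bary m (f (vertex b)) ≤ 1 / 2 := by linarith [nB i]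
    have hwt : 0 < (1 - t) * bary m (f (vertex a)) + t * bary m (f (vertex b)) := by
      rcases (nA m).eq_or_lt with h | h
      · have : 0 < bary m (f (vertex b)) := by linarith
        have := mul_pos ht0 this
        rw [← h]; linarith
      · have := mul_pos (sub_pos.2 ht1) h
        have := mul_nonneg ht0.le (nB m)
        linarith
    rcases eq_or_eq_or_eq hij hjm him l with rfl | rfl | rfl
    · linarith
    · linarith
    · by_cases hh : 1 / 2 ≤ bary l (f (vertex a))
      · nlinarith [hm hh]
      · nlinarith
  · have ha0 : bary m (f (vertex a)) = 0 := by linarith [nA m, nB m]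
    have hb0 : bary m (f (vertex b)) = 0 := by linarith [nA m, nB m]
    obtain ⟨c, hbc, hac⟩ := exists_third hab
    have hC := hG _ (vertex_mem_gasket c)
    obtain ⟨-, e1, e2, e3⟩ := apex hij hjm him hf.pos ha0 hb0 (bary_nonneg hC m)
      (hf.dist_vertex hab) (hf.dist_vertex hac) (hf.dist_vertex hbc) (by linarith)
    obtain ⟨l, hl⟩ := exists_half_le_bary hC
    rcases eq_or_eq_or_eq hij hjm him l with rfl | rfl | rfl <;> linarith

/-- A similar copy of the gasket in the gasket with ratio less than `1 / 2` lies in a first-level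
cell. -/
theorem IsSim.exists_homothety_two_mem {k : ℝ} {f : Plane →ᵃ[ℝ] Plane} (hf : IsSim k f)
    (hk : k < 1 / 2) (hG : ∀ p ∈ sierpinskiGasket, f p ∈ sierpinskiGasket) :
    ∃ i, ∀ p ∈ sierpinskiGasket,
      AffineMap.homothety (vertex i) (2 : ℝ) (f p) ∈ sierpinskiGasket := by
  suffices h : ∃ i, ∀ a, 1 / 2 ≤ bary i (f (vertex a)) by
    obtain ⟨i, hi⟩ := h
    exact ⟨i, fun p hp => homothety_two_mem_gasket (hG p hp)
      (le_apply_of_mem_gasket ((bary i).comp f) hi hp)⟩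
  obtain ⟨x, x0, x1⟩ := hf.exists_half_le_bary_pair hk hG (a := 0) (b := 1) (by decide)
  obtain ⟨y, y1, y2⟩ := hf.exists_half_le_bary_pair hk hG (a := 1) (b := 2) (by decide)
  obtain ⟨z, z0, z2⟩ := hf.exists_half_le_bary_pair hk hG (a := 0) (b := 2) (by decide)
  by_cases hxy : x = y
  · subst hxy
    exact ⟨x, fun a => by fin_cases a <;> assumption⟩
  by_cases hxz : x = z
  · subst hxz
    exact ⟨x, fun a => by fin_cases a <;> assumption⟩
  by_cases hyz : y = z
  · subst hyz
    exact ⟨y, fun a => by fin_cases a <;> assumption⟩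
  -- otherwise the vertices are the three common points of the cells, at distance `1 / 2`
  exfalso
  have n0 := bary_nonneg (hG _ (vertex_mem_gasket 0))
  have n1 := bary_nonneg (hG _ (vertex_mem_gasket 1))
  have s0 := bary_sum hxy hyz hxz (f (vertex 0))
  have s1 := bary_sum hxy hyz hxz (f (vertex 1))
  have d := dist_sq_eq hxy hyz hxz (f (vertex 0)) (f (vertex 1))
  have n0x := n0 x; have n0y := n0 y; have n0z := n0 z
  have n1x := n1 x; have n1y := n1 y; have n1z := n1 z
  rw [hf.dist_vertex (by decide), show bary x (f (vertex 0)) = 1 / 2 by linarith,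
    show bary y (f (vertex 0)) = 0 by linarith, show bary z (f (vertex 0)) = 1 / 2 by linarith,
    show bary x (f (vertex 1)) = 1 / 2 by linarith, show bary y (f (vertex 1)) = 1 / 2 by linarith,
    show bary z (f (vertex 1)) = 0 by linarith] at d
  nlinarith [hf.pos]

/-- A similar copy of the gasket in the gasket with ratio less than `1 / 4` lies in a second-level
cell, so each coordinate varies in one of the four intervals of length `1 / 4`. -/
theorem IsSim.exists_quarter {k : ℝ} {f : Plane →ᵃ[ℝ] Plane} (hf : IsSim k f)
    (hk : k < 1 / 4) (hG : ∀ p ∈ sierpinskiGasket, f p ∈ sierpinskiGasket) (i : Fin 3) :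
    ∃ n : Fin 4, ∀ p ∈ sierpinskiGasket,
      (n : ℝ) / 4 ≤ bary i (f p) ∧ bary i (f p) ≤ ((n : ℝ) + 1) / 4 := by
  obtain ⟨a, ha⟩ := hf.exists_homothety_two_mem (by linarith) hG
  obtain ⟨b, hb⟩ := (hf.homothety_two_comp (vertex a)).exists_homothety_two_mem (by linarith) ha
  refine ⟨(if i = a then 2 else 0) + (if i = b then 1 else 0), fun p hp => ?_⟩
  have h0 := bary_nonneg (hb p hp) i
  have h1 := bary_le_one (hb p hp) i
  rw [bary_homothety, AffineMap.comp_apply, bary_homothety] at h0 h1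
  split_ifs at h0 h1 ⊢ <;> norm_num [Fin.val_add] at h0 h1 ⊢ <;> constructor <;> linarith

/-! ### Similar copies of the five-Sierpinski in the gasket -/

theorem dist_le_one_of_mem_gasket {p q : Plane} (hp : p ∈ sierpinskiGasket)
    (hq : q ∈ sierpinskiGasket) : dist p q ≤ 1 := by
  have d := dist_sq_eq (i := 0) (j := 1) (m := 2) (by decide) (by decide) (by decide) p q
  have sp := sum_bary_eq_one p
  have sq := sum_bary_eq_one q
  have e (i : Fin 3) : (bary i p - bary i q) ^ 2 ≤ bary i p + bary i q := by
    nlinarith [bary_nonneg hp i, bary_nonneg hq i, bary_le_one hp i, bary_le_one hq i,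
      mul_nonneg (bary_nonneg hp i) (bary_nonneg hq i)]
  have e0 := e 0; have e1 := e 1; have e2 := e 2
  exact (sq_le_one_iff₀ dist_nonneg).1 (by linarith)

theorem apply_shift (φ : Plane →ᵃ[ℝ] ℝ) (t : ℝ) (p : Plane) :
    φ (shift t p) = φ p + t * (φ (vertex 2) - φ (vertex 0)) := by
  rw [affine_apply_eq_sum φ p, affine_apply_eq_sum φ (shift t p)]
  simp only [Fin.sum_univ_three, bary_shift]
  simp
  ring

theorem shift_succ_vertex_zero (a : ℕ) :
    shift ((a + 1 : ℕ) : ℝ) (vertex 0) = shift a (vertex 2) := by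
  refine eq_of_bary fun l => ?_
  rw [bary_shift, bary_shift, bary_vertex, bary_vertex]
  fin_cases l <;> simp [add_comm]

theorem shift_zero_apply (p : Plane) : shift (0 : ℕ) p = p := by
  refine eq_of_bary fun l => ?_
  rw [bary_shift]
  fin_cases l <;> simp

/-- An affine function that is nonnegative at the ends and zero at the common point of the bases of
two neighbouring triangles is zero along the line of these bases. -/
theorem apply_vertex_eq_zero (φ : Plane →ᵃ[ℝ] ℝ) (t : ℝ) (h0 : 0 ≤ φ (shift t (vertex 0)))
    (h1 : φ (shift t (vertex 2)) = 0) (h2 : 0 ≤ φ (shift (t + 1) (vertex 2))) :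
    φ (vertex 0) = 0 ∧ φ (vertex 2) = 0 := by
  rw [apply_shift] at h0 h1 h2
  have hs : φ (vertex 2) - φ (vertex 0) = 0 := by linarith
  rw [hs] at h1
  constructor <;> linarith

theorem IsSim.bary_apply_shift_le {k : ℝ} {f : Plane →ᵃ[ℝ] Plane} (hf : IsSim k f) {m : Fin 3}
    (h0 : bary m (f (vertex 0)) = 0) (h2 : bary m (f (vertex 2)) = 0)
    (h1 : 0 ≤ bary m (f (vertex 1))) (t : ℝ) {p : Plane} (hp : p ∈ sierpinskiGasket) :
    bary m (f (shift t p)) ≤ k := by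
  obtain ⟨i, hi⟩ : ∃ i, i ≠ m := ⟨m + 1, by clear h0 h1 h2; revert m; decide⟩
  have h := apply_shift ((bary m).comp f) t p
  rw [affine_apply_eq_sum ((bary m).comp f) p] at h
  simp only [AffineMap.comp_apply, Fin.sum_univ_three, h0, h2, (hf.height h0 h2 h1 hi).1] at h
  rw [h]
  nlinarith [bary_le_one hp 1, hf.pos]

theorem IsSim.le_fifth {k : ℝ} {f : Plane →ᵃ[ℝ] Plane} (hf : IsSim k f)
    (hG : ∀ j < 5, ∀ p ∈ sierpinskiGasket, f (shift (j : ℕ) p) ∈ sierpinskiGasket) :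
    k ≤ 1 / 5 := by
  have h := dist_le_one_of_mem_gasket (hG 0 (by norm_num) _ (vertex_mem_gasket 0))
    (hG 4 (by norm_num) _ (vertex_mem_gasket 2))
  have d := dist_sq_eq (i := 0) (j := 1) (m := 2) (by decide) (by decide) (by decide)
    (shift (0 : ℕ) (vertex 0)) (shift (4 : ℕ) (vertex 2))
  rw [hf.dist_eq] at h
  set D := dist (shift (0 : ℕ) (vertex 0)) (shift (4 : ℕ) (vertex 2))
  have hD : D = 5 := by
    refine (sq_eq_sq₀ dist_nonneg (by norm_num)).1 ?_
    rw [d]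
    simp [bary_shift, bary_vertex]
    norm_num
  rw [hD] at h
  linarith

/-- If the base of a five-Sierpinski in the gasket lies on a side of the triangle, then the five
gaskets have their bases in the four intervals of length `1 / 4` of this side, so two of them share
an interval, whose length is at least `2 * k`. -/
theorem IsSim.le_eighth {k : ℝ} {f : Plane →ᵃ[ℝ] Plane} (hf : IsSim k f)
    (hG : ∀ j < 5, ∀ p ∈ sierpinskiGasket, f (shift (j : ℕ) p) ∈ sierpinskiGasket) {i : Fin 3}
    (hi : |bary i (f (vertex 2)) - bary i (f (vertex 0))| = k) : k ≤ 1 / 8 := by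
  have hk := hf.le_fifth hG
  have h (j : Fin 5) := (hf.comp_shift (j : ℕ)).exists_quarter (by linarith) (hG j j.2) i
  choose n hn using h
  have key : ∀ a b : Fin 5, a < b → n a = n b → k ≤ 1 / 8 := by
    intro a b hab hnab
    have hab' : ((a : ℕ) : ℝ) + 1 ≤ ((b : ℕ) : ℝ) := by exact_mod_cast hab
    have ha := hn a _ (vertex_mem_gasket 0)
    have hb := hn b _ (vertex_mem_gasket 2)
    rw [← hnab] at hb
    have ea := apply_shift ((bary i).comp f) (a : ℕ) (vertex 0)
    have eb := apply_shift ((bary i).comp f) (b : ℕ) (vertex 2)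
    simp only [AffineMap.comp_apply] at ea eb ha hb
    rw [ea] at ha
    rw [eb] at hb
    have hpos := hf.pos
    rcases abs_cases (bary i (f (vertex 2)) - bary i (f (vertex 0))) with ⟨h, -⟩ | ⟨h, -⟩
    · rw [h] at hi
      rw [hi] at ha hb
      nlinarith
    · rw [h] at hi
      rw [show bary i (f (vertex 2)) - bary i (f (vertex 0)) = -k by linarith] at ha hb
      nlinarith
  obtain ⟨a, b, hab, hnab⟩ := Fintype.exists_ne_map_eq_of_card_lt n (by simp)
  rcases lt_or_gt_of_ne hab with h | h
  · exact key a b h hnab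
  · exact key b a h hnab.symm

/-- A similar copy of the five-Sierpinski inside the gasket does not contain any `spiralPoint`.

As long as the copy lies in a first-level cell, doubling produces a larger copy, and the point
moves along its cycle. A copy of maximal size spreads over two neighbouring cells, so its base is
on a side of the triangle, and its height, at most `1 / 8`, is less than the distance `1 / 7` of
the point from that side (in units of the height of the gasket). -/
theorem IsSim.apply_shift_ne_spiralPoint (n : ℕ) {k : ℝ} {f : Plane →ᵃ[ℝ] Plane}
    (hf : IsSim k f) (hk : 1 / 5 < 2 ^ n * k)
    (hG : ∀ j < 5, ∀ p ∈ sierpinskiGasket, f (shift (j : ℕ) p) ∈ sierpinskiGasket)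
    {j : ℕ} (hj : j < 5) {p : Plane} (hp : p ∈ sierpinskiGasket) (i : Fin 3) :
    f (shift j p) ≠ spiralPoint i := by
  have hk5 := hf.le_fifth hG
  induction n generalizing k f p i with
  | zero => linarith
  | succ n ih =>
    have hcell : ∀ j : ℕ, j < 5 → ∃ i, ∀ p ∈ sierpinskiGasket,
        AffineMap.homothety (vertex i) (2 : ℝ) (f (shift j p)) ∈ sierpinskiGasket :=
      fun j hj => (hf.comp_shift j).exists_homothety_two_mem (by linarith) (hG j hj)
    choose! c hc using hcell
    intro hfp
    by_cases hall : ∀ j < 4, c j = c (j + 1)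
    · have hc0 : ∀ j < 5, c j = c 0 := by
        intro j hj
        induction j with
        | zero => rfl
        | succ j ih => rw [← hall j (by omega), ih (by omega)]
      have hi : c 0 = i := by
        by_contra hne
        have h := bary_nonneg (hc j hj p hp) (c 0)
        rw [hfp, hc0 j hj, bary_homothety, bary_spiralPoint, if_neg hne, if_pos rfl] at h
        split_ifs at h <;> norm_num at h
      have hG' : ∀ j < 5, ∀ p ∈ sierpinskiGasket,
          (AffineMap.homothety (vertex (c 0)) (2 : ℝ)).comp f (shift (j : ℕ) p)
            ∈ sierpinskiGasket := by
        intro j hj p hp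
        have := hc j hj p hp
        rwa [hc0 j hj] at this
      have hf' := hf.homothety_two_comp (vertex (c 0))
      refine ih hf' ?_ hG' hp (i + 1) (hf'.le_fifth hG') ?_
      · rw [pow_succ] at hk; linarith
      · rw [AffineMap.comp_apply, hfp, hi, homothety_two_spiralPoint]
    · push Not at hall
      obtain ⟨a, ha, hne⟩ := hall
      obtain ⟨m, hm', hm⟩ := exists_third hne
      -- the common point of the two gaskets is common to the two cells
      have hqm : bary m (f (shift a (vertex 2))) = 0 := by
        have h1 := bary_nonneg (hc a (by omega) _ (vertex_mem_gasket 2)) (c a)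
        have h2 := bary_nonneg (hc (a + 1) (by omega) _ (vertex_mem_gasket 0)) (c (a + 1))
        have h3 := bary_nonneg (hG a (by omega) _ (vertex_mem_gasket 2)) m
        have h4 := bary_sum hne hm' hm (f (shift a (vertex 2)))
        rw [shift_succ_vertex_zero] at h2
        rw [bary_homothety, if_pos rfl] at h1 h2
        linarith
      obtain ⟨h0, h2⟩ := apply_vertex_eq_zero ((bary m).comp f) a
        (bary_nonneg (hG a (by omega) _ (vertex_mem_gasket 0)) m) hqm (by
          have := bary_nonneg (hG (a + 1) (by omega) _ (vertex_mem_gasket 2)) m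
          push_cast at this
          exact this)
      have h1 : 0 ≤ bary m (f (vertex 1)) := by
        simpa only [shift_zero_apply] using bary_nonneg (hG 0 (by omega) _ (vertex_mem_gasket 1)) m
      have hle := hf.bary_apply_shift_le h0 h2 h1 j hp
      have h8 := hf.le_eighth hG (hf.height h0 h2 h1 hm).2
      rw [hfp, bary_spiralPoint] at hle
      split_ifs at hle <;> linarith

/-! ### Similar copies of the gasket in the five-Sierpinski -/

theorem mem_fiveSierpinski {p : Plane} :
    p ∈ fiveSierpinski ↔ ∃ n : ℕ, n < 5 ∧ ∃ q ∈ sierpinskiGasket, shift n q = p := by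
  have key (N : ℕ) : p ∈ nSierpinski N ↔ ∃ n : ℕ, n < N ∧ ∃ q ∈ sierpinskiGasket,
      shift n q = p := by
    induction N with
    | zero => simp [nSierpinski]
    | succ N ih =>
      simp only [nSierpinski, Set.mem_union, ih, Set.mem_image, Nat.lt_succ_iff_lt_or_eq,
        or_and_right, exists_or, exists_eq_left, shift_apply]
  exact key 5

theorem bary_one_nonneg {p : Plane} (hp : p ∈ fiveSierpinski) : 0 ≤ bary 1 p := by
  obtain ⟨n, -, q, hq, rfl⟩ := mem_fiveSierpinski.1 hp
  simpa [bary_shift] using bary_nonneg hq 1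

/-- The five-Sierpinski lies in the triangles to the left and to the right of the point
`(m, 0)`. -/
theorem le_bary_two_or_of_mem (m : ℕ) {p : Plane} (hp : p ∈ fiveSierpinski) :
    m ≤ bary 2 p ∨ 1 - bary 0 p ≤ m := by
  obtain ⟨n, -, q, hq, rfl⟩ := mem_fiveSierpinski.1 hp
  have h0 := bary_nonneg hq 0
  have h2 := bary_nonneg hq 2
  simp only [bary_shift]
  rcases le_or_gt m n with h | h
  · left
    have : (m : ℝ) ≤ n := by exact_mod_cast h
    simp; linarith
  · right
    have : (n : ℝ) + 1 ≤ m := by exact_mod_cast h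
    simp; linarith

/-- A point of the five-Sierpinski in the triangle of one of its gaskets is in that gasket. -/
theorem shift_neg_mem_gasket {p : Plane} (hp : p ∈ fiveSierpinski) {n : ℕ}
    (h2 : n ≤ bary 2 p) (h0 : 1 - bary 0 p ≤ n + 1) : shift (-n) p ∈ sierpinskiGasket := by
  obtain ⟨m, -, q, hq, rfl⟩ := mem_fiveSierpinski.1 hp
  have n0 := bary_nonneg hq 0
  have n1 := bary_nonneg hq 1
  have n2 := bary_nonneg hq 2
  have hs := sum_bary_eq_one q
  simp only [bary_shift] at h0 h2
  simp at h0 h2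
  rw [shift_shift]
  by_cases hmn : m = n
  · subst hmn
    convert hq using 1
    refine eq_of_bary fun l => ?_
    rw [bary_shift]
    fin_cases l <;> simp
  · -- only the common vertices of neighbouring gaskets are in doubt
    have h1 : bary 1 q = 0 := by
      rcases lt_or_gt_of_ne hmn with h | h
      · have : (m : ℝ) + 1 ≤ n := by exact_mod_cast h
        linarith
      · have : (n : ℝ) + 1 ≤ m := by exact_mod_cast h
        linarith
    refine mem_gasket_of_bary_eq_zero (m := 1) (fun l => ?_) ?_
    · rw [bary_shift]
      fin_cases l <;> simp <;> linarith
    · rw [bary_shift]; simpa using h1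

/-- A similar copy of the gasket in the five-Sierpinski does not cross the point `(m, 0)`. -/
theorem IsSim.le_bary_two_or {k : ℝ} {f : Plane →ᵃ[ℝ] Plane} (hf : IsSim k f)
    (hE : ∀ p ∈ sierpinskiGasket, f p ∈ fiveSierpinski) (m : ℕ) :
    (∀ p ∈ sierpinskiGasket, m ≤ bary 2 (f p)) ∨
      ∀ p ∈ sierpinskiGasket, 1 - bary 0 (f p) ≤ m := by
  by_contra! hcon
  obtain ⟨h2, h0⟩ := hcon
  obtain ⟨a, ha⟩ : ∃ a, bary 2 (f (vertex a)) < m := by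
    by_contra! h
    obtain ⟨p, hp, hlt⟩ := h2
    exact hlt.not_ge (le_apply_of_mem_gasket ((bary 2).comp f) h hp)
  obtain ⟨b, hb⟩ : ∃ b, bary 0 (f (vertex b)) < 1 - m := by
    by_contra! h
    obtain ⟨p, hp, hlt⟩ := h0
    have : 1 - (m : ℝ) ≤ bary 0 (f p) := le_apply_of_mem_gasket ((bary 0).comp f) h hp
    linarith
  have hA := hE _ (vertex_mem_gasket a)
  have hB := hE _ (vertex_mem_gasket b)
  have ha' := (le_bary_two_or_of_mem m hA).resolve_left (by linarith)
  have hb' := (le_bary_two_or_of_mem m hB).resolve_right (by linarith)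
  have nA := bary_one_nonneg hA
  have nB := bary_one_nonneg hB
  have sA := sum_bary_eq_one (f (vertex a))
  have sB := sum_bary_eq_one (f (vertex b))
  have hab : a ≠ b := by rintro rfl; linarith
  by_cases hpos : 0 < bary 1 (f (vertex a)) + bary 1 (f (vertex b))
  · -- the point of the segment on the vertical line through `(m, 0)` is above this point
    have hseg (t : ℝ) (h0 : 0 ≤ t) (h1 : t ≤ 1) :
        AffineMap.lineMap (f (vertex a)) (f (vertex b)) t ∈ fiveSierpinski := by
      rw [← AffineMap.apply_lineMap]
      exact hE _ (lineMap_mem_gasket a b h0 h1)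
    set d := m - (bary 2 (f (vertex a)) + bary 1 (f (vertex a)) / 2) with hd
    set e := bary 2 (f (vertex b)) + bary 1 (f (vertex b)) / 2 - m with he
    have hd0 : 0 < d := by linarith
    have he0 : 0 < e := by linarith
    have ht0 : 0 < d / (d + e) := by positivity
    have ht1 : d / (d + e) < 1 := by rw [div_lt_one (by positivity)]; linarith
    have hmul : d / (d + e) * (d + e) = d := div_mul_cancel₀ _ (by positivity)
    set t := d / (d + e)
    have hp := hseg t ht0.le ht1.le
    have sp := sum_bary_eq_one (AffineMap.lineMap (f (vertex a)) (f (vertex b)) t)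
    have hor := le_bary_two_or_of_mem m hp
    simp only [bary_lineMap] at sp hor
    have heq : (1 - t) * bary 2 (f (vertex a)) + t * bary 2 (f (vertex b)) +
        ((1 - t) * bary 1 (f (vertex a)) + t * bary 1 (f (vertex b))) / 2 = m := by
      rw [hd, he] at hmul
      linear_combination hmul
    have hwt : 0 < (1 - t) * bary 1 (f (vertex a)) + t * bary 1 (f (vertex b)) := by
      rcases nA.eq_or_lt with h | h
      · have : 0 < bary 1 (f (vertex b)) := by linarith
        have := mul_pos ht0 this
        rw [← h]; linarith
      · have := mul_pos (sub_pos.2 ht1) h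
        have := mul_nonneg ht0.le nB
        linarith
    rcases hor with h | h <;> linarith
  · obtain ⟨c, hbc, hac⟩ := exists_third hab
    have hC := hE _ (vertex_mem_gasket c)
    obtain ⟨-, e1, e2, e3⟩ := apex (i := 0) (j := 2) (m := 1) (by decide) (by decide) (by decide)
      hf.pos (by linarith) (by linarith) (bary_one_nonneg hC)
      (hf.dist_vertex hab) (hf.dist_vertex hac) (hf.dist_vertex hbc) (by linarith)
    rcases le_bary_two_or_of_mem m hC with h | h <;> linarith

/-- A similar copy of the gasket in the five-Sierpinski lies in one of its five gaskets. -/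
theorem IsSim.exists_shift_neg_mem {k : ℝ} {f : Plane →ᵃ[ℝ] Plane} (hf : IsSim k f)
    (hE : ∀ p ∈ sierpinskiGasket, f p ∈ fiveSierpinski) :
    ∃ n < 5, ∀ p ∈ sierpinskiGasket, shift (-(n : ℕ)) (f p) ∈ sierpinskiGasket := by
  have key := hf.le_bary_two_or hE
  have hleft : ∀ p ∈ sierpinskiGasket, ((0 : ℕ) : ℝ) ≤ bary 2 (f p) := by
    intro p hp
    obtain ⟨n, -, q, hq, h⟩ := mem_fiveSierpinski.1 (hE p hp)
    rw [← h, bary_shift]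
    have := bary_nonneg hq 2
    simp; positivity
  have hright : ∀ p ∈ sierpinskiGasket, 1 - bary 0 (f p) ≤ (5 : ℕ) := by
    intro p hp
    obtain ⟨n, hn, q, hq, h⟩ := mem_fiveSierpinski.1 (hE p hp)
    rw [← h, bary_shift]
    have := bary_nonneg hq 0
    have : (n : ℝ) + 1 ≤ 5 := by exact_mod_cast hn
    simp; linarith
  have hn : ∃ n < 5, (∀ p ∈ sierpinskiGasket, (n : ℕ) ≤ bary 2 (f p)) ∧
      ∀ p ∈ sierpinskiGasket, 1 - bary 0 (f p) ≤ ((n + 1 : ℕ) : ℝ) := by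
    rcases key 1 with h1 | h1
    · rcases key 2 with h2 | h2
      · rcases key 3 with h3 | h3
        · rcases key 4 with h4 | h4
          · exact ⟨4, by norm_num, h4, hright⟩
          · exact ⟨3, by norm_num, h3, h4⟩
        · exact ⟨2, by norm_num, h2, h3⟩
      · exact ⟨1, by norm_num, h1, h2⟩
    · exact ⟨0, by norm_num, hleft, h1⟩
  obtain ⟨n, hn5, h2, h0⟩ := hn
  exact ⟨n, hn5, fun p hp => shift_neg_mem_gasket (hE p hp) (h2 p hp) (by
    have := h0 p hp
    push_cast at this
    exact this)⟩

/-! ### Similar copies of the five-Sierpinski in itself -/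

/-- If five consecutive intervals of length `k > 1 / 2` lie in the intervals `[n, n + 1]`, `n < 5`,
then each lies in a different one, in order, and the gap between the first and the last forces
`1 ≤ k`. -/
theorem one_le_of_row {k s x : ℝ} (hk : 1 / 2 < k) (hs : |s| = k) {n : ℕ → ℕ}
    (hn : ∀ j < 5, n j < 5)
    (h0 : ∀ j < 5, n j ≤ x + j * s ∧ x + j * s ≤ n j + 1)
    (h1 : ∀ j < 5, n j ≤ x + (j + 1) * s ∧ x + (j + 1) * s ≤ n j + 1) : 1 ≤ k := by
  rcases abs_cases s with ⟨h, -⟩ | ⟨h, -⟩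
  · have hmono : ∀ j < 4, n j < n (j + 1) := by
      intro j hj
      have := (h0 j (by omega)).1
      have h2 := (h1 (j + 1) (by omega)).2
      push_cast at h2
      have : (n j : ℝ) < n (j + 1) := by linarith
      exact_mod_cast this
    have m0 : n 0 < n 1 := hmono 0 (by norm_num)
    have m1 : n 1 < n 2 := hmono 1 (by norm_num)
    have m2 : n 2 < n 3 := hmono 2 (by norm_num)
    have m3 : n 3 < n 4 := hmono 3 (by norm_num)
    have := hn 4 (by norm_num)
    have e0 : n 0 = 0 := by omega
    have e4 : n 4 = 4 := by omega
    have i0 := (h1 0 (by norm_num)).2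
    have i4 := (h0 4 (by norm_num)).1
    rw [e0] at i0
    rw [e4] at i4
    norm_num at i0 i4
    linarith
  · have hmono : ∀ j < 4, n (j + 1) < n j := by
      intro j hj
      have := (h0 j (by omega)).2
      have h2 := (h1 (j + 1) (by omega)).1
      push_cast at h2
      have : (n (j + 1) : ℝ) < n j := by linarith
      exact_mod_cast this
    have m0 : n 1 < n 0 := hmono 0 (by norm_num)
    have m1 : n 2 < n 1 := hmono 1 (by norm_num)
    have m2 : n 3 < n 2 := hmono 2 (by norm_num)
    have m3 : n 4 < n 3 := hmono 3 (by norm_num)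
    have := hn 0 (by norm_num)
    have e0 : n 0 = 4 := by omega
    have e4 : n 4 = 0 := by omega
    have i0 := (h1 0 (by norm_num)).1
    have i4 := (h0 4 (by norm_num)).2
    rw [e0] at i0
    rw [e4] at i4
    norm_num at i0 i4
    linarith

/-- No contracted copy of the five-Sierpinski in the five-Sierpinski contains the `spiralPoint` of
the first gasket that is nearest to the top. -/
theorem IsSim.apply_ne_spiralPoint {k : ℝ} {f : Plane →ᵃ[ℝ] Plane} (hf : IsSim k f) (hk : k < 1)
    (hE : ∀ p ∈ fiveSierpinski, f p ∈ fiveSierpinski) {p : Plane} (hp : p ∈ fiveSierpinski) :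
    f p ≠ spiralPoint 1 := by
  intro hfp
  obtain ⟨j, hj, q, hq, rfl⟩ := mem_fiveSierpinski.1 hp
  have hE' : ∀ j < 5, ∀ p ∈ sierpinskiGasket, f (shift (j : ℕ) p) ∈ fiveSierpinski :=
    fun j hj p hp => hE _ (mem_fiveSierpinski.2 ⟨j, hj, p, hp, rfl⟩)
  have hcell : ∀ j : ℕ, j < 5 → ∃ n < 5, ∀ p ∈ sierpinskiGasket,
      shift (-(n : ℕ)) (f (shift j p)) ∈ sierpinskiGasket :=
    fun j hj => (hf.comp_shift j).exists_shift_neg_mem (hE' j hj)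
  choose! n hn hc using hcell
  have sp : bary 2 (spiralPoint 1) = 2 / 7 := by rw [bary_spiralPoint]; simp
  by_cases hall : ∀ j < 4, n j = n (j + 1)
  · have hn0 : ∀ j < 5, n j = n 0 := by
      intro j hj
      induction j with
      | zero => rfl
      | succ j ih => rw [← hall j (by omega), ih (by omega)]
    have hz : n 0 = 0 := by
      have h := bary_nonneg (hc j hj q hq) 2
      rw [hfp, hn0 j hj, bary_shift, sp] at h
      simp at h
      have : (n 0 : ℝ) < 1 := by linarith
      exact Nat.lt_one_iff.1 (by exact_mod_cast this)
    have hG : ∀ j < 5, ∀ p ∈ sierpinskiGasket, f (shift (j : ℕ) p) ∈ sierpinskiGasket := by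
      intro j hj p hp
      have := hc j hj p hp
      rw [hn0 j hj, hz] at this
      convert this using 1
      simp [shift_apply]
    obtain ⟨N, hN⟩ := pow_unbounded_of_one_lt (1 / 5 / k) (one_lt_two (α := ℝ))
    exact hf.apply_shift_ne_spiralPoint N ((div_lt_iff₀ hf.pos).1 hN) hG hj hq 1 hfp
  · push Not at hall
    obtain ⟨a, ha, hne⟩ := hall
    have hq1 : bary 1 (f (shift a (vertex 2))) = 0 := by
      have hA := hc a (by omega) _ (vertex_mem_gasket 2)
      have hB := hc (a + 1) (by omega) _ (vertex_mem_gasket 0)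
      rw [shift_succ_vertex_zero] at hB
      have hs := sum_bary_eq_one (f (shift a (vertex 2)))
      have h0 := bary_nonneg hA 0
      have h1 := bary_nonneg hA 1
      have h2 := bary_nonneg hA 2
      have h0' := bary_nonneg hB 0
      have h2' := bary_nonneg hB 2
      simp only [bary_shift] at h0 h1 h2 h0' h2'
      simp at h0 h1 h2 h0' h2'
      rcases lt_or_gt_of_ne hne with h | h
      · have : (n a : ℝ) + 1 ≤ n (a + 1) := by exact_mod_cast h
        linarith
      · have : (n (a + 1) : ℝ) + 1 ≤ n a := by exact_mod_cast h
        linarith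
    obtain ⟨h0, h2⟩ := apply_vertex_eq_zero ((bary 1).comp f) a
      (bary_one_nonneg (hE' a (by omega) _ (vertex_mem_gasket 0))) hq1 (by
        have := bary_one_nonneg (hE' (a + 1) (by omega) _ (vertex_mem_gasket 2))
        push_cast at this
        exact this)
    have h1 : 0 ≤ bary 1 (f (vertex 1)) := by
      simpa only [shift_zero_apply] using bary_one_nonneg (hE' 0 (by omega) _ (vertex_mem_gasket 1))
    have hle := hf.bary_apply_shift_le h0 h2 h1 j hq
    rw [hfp, bary_spiralPoint, if_pos rfl] at hle
    have hrow (j : ℕ) (hj : j < 5) (p : Plane) (hp : p ∈ sierpinskiGasket) :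
        n j ≤ bary 2 (f (shift j p)) ∧ bary 2 (f (shift j p)) ≤ n j + 1 := by
      have b0 := bary_nonneg (hc j hj p hp) 2
      have b1 := bary_le_one (hc j hj p hp) 2
      rw [bary_shift] at b0 b1
      simp at b0 b1
      constructor <;> linarith
    have hx (j : ℕ) (v : Plane) := apply_shift ((bary 2).comp f) j v
    simp only [AffineMap.comp_apply] at hx
    refine hk.not_ge (one_le_of_row (n := n) (x := bary 2 (f (vertex 0))) (by linarith)
      (hf.height h0 h2 h1 (i := 2) (by decide)).2 hn (fun j hj => ?_) fun j hj => ?_)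
    · rw [← hx]
      exact hrow j hj _ (vertex_mem_gasket 0)
    · have := hrow j hj _ (vertex_mem_gasket 2)
      rw [hx] at this
      convert this using 2 <;> ring

end FiveSierpinski

theorem theorem3p1 :
    ¬ ∃ F : FiveSierpinski.IFS, F.IsContractiveSimilitudes ∧
      F.IsAttractor FiveSierpinski.fiveSierpinski := by
  rintro ⟨F, hF, -, -, hE⟩
  have hmem : FiveSierpinski.spiralPoint 1 ∈ FiveSierpinski.fiveSierpinski :=
    FiveSierpinski.mem_fiveSierpinski.2
      ⟨0, by norm_num, _, FiveSierpinski.spiralPoint_mem_gasket 1, by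
        simp [FiveSierpinski.shift_apply]⟩
  rw [hE] at hmem
  obtain ⟨i, p, hp, hfp⟩ := Set.mem_iUnion.1 hmem
  obtain ⟨k, hk, hsim⟩ := hF i
  obtain ⟨g, hg, hgf⟩ := hsim.exists_isSim
  refine hg.apply_ne_spiralPoint hk (fun q hq => ?_) hp ((hgf p).trans hfp)
  rw [hgf, hE]
  exact Set.mem_iUnion.2 ⟨i, q, hq, rfl⟩
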